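/- Let $X$ be a metric space of bounded geometry, i.e. for every $R>0$ there is $N_R\in\mathbb N$ such that every closed ball $B(x;R)=\{y\in X: d(x,y)\le R\}$ has at most $N_R$ points. If $X$ has the operator norm localisation property (ONL), then $X$ has uniform local amenability (ULA). Here the two properties are defined as follows. **ONL.** For a probability measure $\mu$ on (all subsets of) $X$ and a nonzero separable complex Hilbert space $\mathcal H$, let $l^2(X,\mu,\mathcal H)$ be the Hilbert space of functions $\phi:X\to\mathcal H$ with $\|\phi\|^2=\sum_{x}\mu(x)\|\phi(x)\|^2<\infty$, modulo functions of norm zero; the support of (the class of) $\phi$ is $\{x:\mu(x)\neq 0,\ \phi(x)\ne 0\}$. Let $\mathbb C_R[X;\mu,\mathcal H]$ be the set of bounded operators $T=(T_{x,y})$ on $l^2(X,\mu,\mathcal H)$ whose matrix entries satisfy $T_{x,y}=0$ whenever $d(x,y)>R$. Then $X$ has ONL if there is $c>0$ such that for every $R>0$ there is $S>0$ such that for every such $\mu$ and $\mathcal H$ and every $T\in\mathbb C_R[X;\mu,\mathcal H]$ there is a unit vector $\phi\in l^2(X,\mu,\mathcal H)$ with $\operatorname{diam}(\operatorname{supp}\phi)\le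 S$ and $\|T\phi\|\ge c\|T\|$. **ULA.** For all $R,\epsilon>0$ there is $S>0$ such that for every nonempty finite $F\subseteq X$ there is $\phi\in l^1(X)$ with $\operatorname{diam}(\operatorname{supp}\phi)\le S$ and $$\sum_{x\in F}\ \sum_{y\in F,\ d(x,y)\le R}|\phi(x)-\phi(y)|<\epsilon\sum_{x\in F}|\phi(x)|;$$ and also (an equivalent property for bounded geometry spaces) for all $R,\epsilon>0$ there is $S>0$ such that for every nonempty finite $F\subseteq X$ there is a finite set $E\subseteq X$ with $\operatorname{diam}(E)\le S$ and $|\partial_RE\cap F|<\epsilon|E\cap F|$, where $\partial_RE=\{y\in X: d(y,E)\le R\}\setminus E$. -/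

import Mathlib

open MeasureTheory
open scoped ENNReal

noncomputable section

namespace CoarseGeometry

/-- Bounded geometry: closed balls of a given radius have uniformly bounded (finite)
cardinality. -/
def BoundedGeometry (X : Type*) [MetricSpace X] : Prop :=
  ∀ R : ℝ, 0 < R → ∃ N : ℕ, ∀ x : X, (Metric.closedBall x R).encard ≤ N

/-- The `R`-boundary `∂_R E = N_R(E) \ E`, where `N_R(E) = {y | d(y, E) ≤ R}`. It is empty when
`E` is empty. -/
def boundary {X : Type*} [MetricSpace X] (R : ℝ) (E : Set X) : Set X :=
  Metric.cthickening R E \ E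

/-- Uniform local amenability, formulated with functions in `l¹(X)`. Diameters are taken in
`[0, ∞]`, so that a set of diameter at most `S` is really bounded. -/
def ULAFunction (X : Type*) [MetricSpace X] : Prop :=
  ∀ R ε : ℝ, 0 < R → 0 < ε → ∃ S : ℝ, 0 < S ∧
    ∀ F : Finset X, F.Nonempty →
      ∃ φ : lp (fun _ : X => ℝ) 1,
        Metric.ediam (Function.support (φ : X → ℝ)) ≤ ENNReal.ofReal S ∧
        ∑ x ∈ F, ∑ y ∈ F with dist x y ≤ R, |φ x - φ y| < ε * ∑ x ∈ F, |φ x|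

/-- Uniform local amenability, formulated with finite sets. -/
def ULASet (X : Type*) [MetricSpace X] : Prop :=
  ∀ R ε : ℝ, 0 < R → 0 < ε → ∃ S : ℝ, 0 < S ∧
    ∀ F : Finset X, F.Nonempty →
      ∃ E : Set X, E.Finite ∧ Metric.ediam E ≤ ENNReal.ofReal S ∧
        ((boundary R E ∩ F).ncard : ℝ) < ε * ((E ∩ F).ncard : ℝ)

/-- The property ULA, in both of its formulations. -/
def ULA (X : Type*) [MetricSpace X] : Prop :=
  ULAFunction X ∧ ULASet X

section Operators

variable {X : Type*} [MeasurableSpace X] [DiscreteMeasurableSpace X]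
variable {H : Type*} [NormedAddCommGroup H] [InnerProductSpace ℂ H]

/-- The support of an element `φ` of `l²(X, μ, H) = Lp H 2 μ`: the points of positive mass at
which `φ` does not vanish. Values at points of mass zero are meaningless. -/
def l2Support {μ : Measure X} (φ : Lp H 2 μ) : Set X :=
  {x | μ {x} ≠ 0 ∧ φ x ≠ 0}

/-- The function with value `v` at `y` and `0` elsewhere, as an element of `l²(X, μ, H)`. -/
def single (μ : Measure X) [IsFiniteMeasure μ] (y : X) (v : H) : Lp H 2 μ :=
  indicatorConstLp 2 (measurableSet_singleton y) (measure_ne_top μ {y}) v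

/-- The matrix entry `T_{x,y} : H → H` of a bounded operator on `l²(X, μ, H)`; it is meaningful
for points `x`, `y` of positive mass. -/
def matrixEntry {μ : Measure X} [IsFiniteMeasure μ] (T : Lp H 2 μ →L[ℂ] Lp H 2 μ)
    (x y : X) (v : H) : H :=
  T (single μ y v) x

end Operators

/-- Membership in `ℂ_R[X; μ, H]`: the matrix entries `T_{x,y}` vanish whenever `d(x, y) > R`. -/
def HasPropagation {X : Type*} [MetricSpace X] [MeasurableSpace X] [DiscreteMeasurableSpace X]
    {H : Type*} [NormedAddCommGroup H] [InnerProductSpace ℂ H]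
    {μ : Measure X} [IsFiniteMeasure μ] (R : ℝ) (T : Lp H 2 μ →L[ℂ] Lp H 2 μ) : Prop :=
  ∀ x y : X, μ {x} ≠ 0 → μ {y} ≠ 0 → R < dist x y → ∀ v : H, matrixEntry T x y v = 0

/-- The operator norm localisation property. Measures are defined on all subsets of `X`. The
Hilbert spaces are nonzero (otherwise there are no unit vectors); every separable Hilbert space
has an isometric copy in `Type`. -/
def ONL (X : Type*) [MetricSpace X] : Prop :=
  letI : MeasurableSpace X := ⊤
  ∃ c : ℝ, 0 < c ∧ ∀ R : ℝ, 0 < R → ∃ S : ℝ, 0 < S ∧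
    ∀ (μ : Measure X) [IsProbabilityMeasure μ]
      (H : Type) [NormedAddCommGroup H] [InnerProductSpace ℂ H] [CompleteSpace H]
      [TopologicalSpace.SeparableSpace H] [Nontrivial H]
      (T : Lp H 2 μ →L[ℂ] Lp H 2 μ), HasPropagation R T →
      ∃ φ : Lp H 2 μ, ‖φ‖ = 1 ∧
        Metric.ediam (l2Support φ) ≤ ENNReal.ofReal S ∧ c * ‖T‖ ≤ ‖T φ‖

end CoarseGeometry

end

/-!
Fix `R`, let `M` bound the number of points in an `R`-ball, and join points of a finite set `F` at
distance at most `R` to form a graph with Laplacian `L`. The averaging operator `W = 1 - L / (2M)`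
on `ℓ²(F)` has propagation `R` and fixes the constants, so `‖Wⁿ‖ ≥ 1` for all `n`. Localisation for
the uniform measure on `F` gives a `v` of support bounded independently of `F` with
`‖Wⁿ v‖ ≥ c ‖v‖`. If `q < 1` and `n` is so large that `qⁿ < c²`, then `‖W w‖² > q ‖w‖²` for one
of the vectors `w = Wᵏ v`, `k < n`, whose support is still bounded. Since
`‖W w‖² ≤ ‖w‖² - 𝓔(w) / (4M)`, where `𝓔` is the Dirichlet energy, `𝓔(w)` is small compared to
`‖w‖²`, and by the Cauchy–Schwarz inequality `|w|²` has small variation in `ℓ¹`. The coarea formula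
turns it into a finite set, one of its superlevel sets.
-/

namespace CoarseGeometry

section LevelSets

variable {X : Type*}

theorem card_superlevel_eq_sum_indicator (F : Finset X) (f : X → ℝ) {t : ℝ} (ht : 0 ≤ t) :
    (({x ∈ F | t < f x} : Finset X).card : ℝ) = ∑ x ∈ F, (Set.Ico 0 (f x)).indicator 1 t := by
  simp [Set.indicator_apply, ht]

variable [MetricSpace X]

theorem ncard_boundary_superlevel_le {R : ℝ} (hR : 0 ≤ R) (F : Finset X) (f : X → ℝ) (t : ℝ) :
    ((boundary R (({x ∈ F | t < f x} : Finset X) : Set X) ∩ F).ncard : ℝ)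
      ≤ ∑ x ∈ F, ∑ y ∈ F with dist x y ≤ R, (Set.Ico (f x) (f y)).indicator 1 t := by
  classical
  have hset : boundary R (({x ∈ F | t < f x} : Finset X) : Set X) ∩ F
      = ({x ∈ F | f x ≤ t ∧ ∃ y ∈ F, t < f y ∧ dist x y ≤ R} : Finset X) := by
    ext x
    simp only [boundary, (Finset.finite_toSet _).isCompact.cthickening_eq_biUnion_closedBall hR,
      Set.mem_inter_iff, Set.mem_sdiff, Set.mem_iUnion, Metric.mem_closedBall, SetLike.mem_coe,
      Finset.mem_filter]
    grind
  rw [hset, Set.ncard_coe_finset, Finset.card_filter, Nat.cast_sum]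
  refine Finset.sum_le_sum fun x _ => ?_
  have hnonneg : ∀ y ∈ F.filter (dist x · ≤ R),
      0 ≤ (Set.Ico (f x) (f y)).indicator (1 : ℝ → ℝ) t :=
    fun y _ => Set.indicator_nonneg (fun _ _ => zero_le_one) t
  split_ifs with h
  · obtain ⟨hx, y, hyF, hy, hxy⟩ := h
    calc ((1 : ℕ) : ℝ) = (Set.Ico (f x) (f y)).indicator 1 t := by simp [hx, hy]
      _ ≤ _ := Finset.single_le_sum hnonneg (Finset.mem_filter.mpr ⟨hyF, hxy⟩)
  · simpa using Finset.sum_nonneg hnonneg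

theorem exists_superlevel_boundary_lt {R ε : ℝ} (hR : 0 ≤ R) {F : Finset X} {f : X → ℝ}
    (hf : ∀ x ∈ F, 0 ≤ f x)
    (h : ∑ x ∈ F, ∑ y ∈ F with dist x y ≤ R, |f x - f y| < ε * ∑ x ∈ F, f x) :
    ∃ t : ℝ, 0 ≤ t ∧ ((boundary R (({x ∈ F | t < f x} : Finset X) : Set X) ∩ F).ncard : ℝ)
      < ε * ({x ∈ F | t < f x} : Finset X).card := by
  set height : ℝ → ℝ := fun t => ∑ x ∈ F, (Set.Ico 0 (f x)).indicator 1 t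
  set jumps : ℝ → ℝ := fun t =>
    ∑ x ∈ F, ∑ y ∈ F with dist x y ≤ R, (Set.Ico (f x) (f y)).indicator 1 t
  have hIco (a b : ℝ) : Integrable ((Set.Ico a b).indicator (1 : ℝ → ℝ)) :=
    (integrable_indicator_iff measurableSet_Ico).mpr (integrable_const (1 : ℝ))
  have integral_height : ∫ t, height t = ∑ x ∈ F, f x := by
    rw [integral_finsetSum _ fun x _ => hIco _ _]
    refine Finset.sum_congr rfl fun x hx => ?_
    rw [integral_indicator_one measurableSet_Ico, Real.volume_real_Ico, sub_zero,
      max_eq_left (hf x hx)]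
  have integral_jumps : ∫ t, jumps t ≤ ∑ x ∈ F, ∑ y ∈ F with dist x y ≤ R, |f x - f y| := by
    rw [integral_finsetSum _ fun x _ => integrable_finsetSum _ fun y _ => hIco _ _]
    refine Finset.sum_le_sum fun x _ => ?_
    rw [integral_finsetSum _ fun y _ => hIco _ _]
    refine Finset.sum_le_sum fun y _ => ?_
    rw [integral_indicator_one measurableSet_Ico, Real.volume_real_Ico, abs_sub_comm]
    exact max_le (le_abs_self _) (abs_nonneg _)
  obtain ⟨t, hlt⟩ : ∃ t, jumps t < ε * height t := by
    by_contra! hle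
    have := integral_mono ((integrable_finsetSum F fun x _ => hIco 0 (f x)).const_mul ε)
      (integrable_finsetSum F fun x _ => integrable_finsetSum _ fun y _ => hIco (f x) (f y)) hle
    rw [integral_const_mul, integral_height] at this
    linarith
  have ht : 0 ≤ t := by
    by_contra! ht
    have height_eq_zero : height t = 0 := Finset.sum_eq_zero fun x _ => by simp [ht.not_ge]
    have jumps_nonneg : 0 ≤ jumps t := Finset.sum_nonneg fun x _ => Finset.sum_nonneg fun y _ =>
      Set.indicator_nonneg (fun _ _ => zero_le_one) t
    rw [height_eq_zero, mul_zero] at hlt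
    exact hlt.not_ge jumps_nonneg
  refine ⟨t, ht, (ncard_boundary_superlevel_le hR F f t).trans_lt ?_⟩
  rwa [card_superlevel_eq_sum_indicator F f ht]

theorem ULAFunction.ulaSet (h : ULAFunction X) : ULASet X := by
  intro R ε hR hε
  obtain ⟨S, hS, h⟩ := h R ε hR hε
  refine ⟨S, hS, fun F hF => ?_⟩
  obtain ⟨φ, hdiam, hφ⟩ := h F hF
  have habs : ∑ x ∈ F, ∑ y ∈ F with dist x y ≤ R, |(|φ x| - |φ y|)| < ε * ∑ x ∈ F, |φ x| :=
    (Finset.sum_le_sum fun _ _ => Finset.sum_le_sum fun _ _ =>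
      abs_abs_sub_abs_le_abs_sub _ _).trans_lt hφ
  obtain ⟨t, ht, hE⟩ := exists_superlevel_boundary_lt hR.le (fun _ _ => abs_nonneg _) habs
  have hsub : (({x ∈ F | t < |φ x|} : Finset X) : Set X) ⊆ Function.support φ := fun x hx =>
    abs_pos.mp (ht.trans_lt (Finset.mem_filter.mp hx).2)
  refine ⟨_, Finset.finite_toSet _, (Metric.ediam_mono hsub).trans hdiam, ?_⟩
  rwa [Set.inter_eq_left.mpr (Finset.coe_subset.mpr (Finset.filter_subset _ F)),
    Set.ncard_coe_finset]

end LevelSets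

section Graph

variable {V : Type*} [Fintype V] (G : SimpleGraph V) [DecidableRel G.Adj]

/-- The Dirichlet energy of a vector-valued function on the vertices of a graph: the sum of the
squared increments along the edges. Each edge is counted twice, once in either direction. -/
noncomputable def dirichletEnergy {E : Type*} [SeminormedAddCommGroup E] (v : V → E) : ℝ :=
  ∑ x, ∑ y ∈ G.neighborFinset x, ‖v x - v y‖ ^ 2

section Energy

variable {E : Type*} [SeminormedAddCommGroup E]

theorem dirichletEnergy_nonneg (v : V → E) : 0 ≤ dirichletEnergy G v :=
  Finset.sum_nonneg fun _ _ => Finset.sum_nonneg fun _ _ => sq_nonneg _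

theorem sum_neighborFinset_swap {A : Type*} [AddCommMonoid A] (g : V → V → A) :
    ∑ x, ∑ y ∈ G.neighborFinset x, g y x = ∑ x, ∑ y ∈ G.neighborFinset x, g x y :=
  Finset.sum_comm' fun x y => by simp [G.adj_comm]

variable {G}

theorem sum_sum_neighborFinset_const_le {M : ℕ} (hM : ∀ x, G.degree x ≤ M) {g : V → ℝ}
    (hg : ∀ x, 0 ≤ g x) : ∑ x, ∑ _y ∈ G.neighborFinset x, g x ≤ M * ∑ x, g x := by
  rw [Finset.mul_sum]
  refine Finset.sum_le_sum fun x _ => ?_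
  rw [Finset.sum_const, G.card_neighborFinset_eq_degree, nsmul_eq_mul]
  exact mul_le_mul_of_nonneg_right (mod_cast hM x) (hg x)

theorem sum_sum_norm_add_norm_sq_le {M : ℕ} (hM : ∀ x, G.degree x ≤ M) (v : V → E) :
    ∑ x, ∑ y ∈ G.neighborFinset x, (‖v x‖ + ‖v y‖) ^ 2 ≤ 4 * M * ∑ x, ‖v x‖ ^ 2 :=
  calc
    _ ≤ ∑ x, ∑ y ∈ G.neighborFinset x, (2 * ‖v x‖ ^ 2 + 2 * ‖v y‖ ^ 2) := by
      gcongr with x _ y _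
      linarith [add_sq_le (a := ‖v x‖) (b := ‖v y‖)]
    _ = 4 * ∑ x, ∑ _y ∈ G.neighborFinset x, ‖v x‖ ^ 2 := by
      simp only [Finset.sum_add_distrib, ← Finset.mul_sum]
      rw [sum_neighborFinset_swap G fun x _ => ‖v x‖ ^ 2]
      ring
    _ ≤ 4 * M * ∑ x, ‖v x‖ ^ 2 := by
      rw [mul_assoc]
      gcongr
      exact sum_sum_neighborFinset_const_le hM fun x => sq_nonneg _

theorem sq_sum_abs_norm_sq_sub_le {M : ℕ} (hM : ∀ x, G.degree x ≤ M) (v : V → E) :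
    (∑ x, ∑ y ∈ G.neighborFinset x, |‖v x‖ ^ 2 - ‖v y‖ ^ 2|) ^ 2
      ≤ dirichletEnergy G v * (4 * M * ∑ x, ‖v x‖ ^ 2) := by
  have hfactor (a b : E) : |‖a‖ ^ 2 - ‖b‖ ^ 2| ≤ ‖a - b‖ * (‖a‖ + ‖b‖) := by
    rw [sq_sub_sq, abs_mul, mul_comm, abs_of_nonneg (add_nonneg (norm_nonneg a) (norm_nonneg b))]
    gcongr
    exact abs_norm_sub_norm_le a b
  calc
    _ ≤ (∑ x, ∑ y ∈ G.neighborFinset x, ‖v x - v y‖ * (‖v x‖ + ‖v y‖)) ^ 2 := by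
      gcongr
      exact hfactor _ _
    _ ≤ dirichletEnergy G v * ∑ x, ∑ y ∈ G.neighborFinset x, (‖v x‖ + ‖v y‖) ^ 2 := by
      simp only [dirichletEnergy, Finset.sum_sigma']
      exact Finset.sum_mul_sq_le_sq_mul_sq _ _ _
    _ ≤ _ := by
      gcongr
      · exact dirichletEnergy_nonneg G v
      · exact sum_sum_norm_add_norm_sq_le hM v

theorem sum_abs_norm_sq_sub_le {M : ℕ} (hM : ∀ x, G.degree x ≤ M) {δ : ℝ} (hδ : 0 ≤ δ) {v : V → E}
    (hv : 4 * M * dirichletEnergy G v ≤ δ ^ 2 * ∑ x, ‖v x‖ ^ 2) :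
    ∑ x, ∑ y ∈ G.neighborFinset x, |‖v x‖ ^ 2 - ‖v y‖ ^ 2| ≤ δ * ∑ x, ‖v x‖ ^ 2 := by
  have hsum : 0 ≤ ∑ x, ‖v x‖ ^ 2 := Finset.sum_nonneg fun _ _ => sq_nonneg _
  refine le_of_sq_le_sq ?_ (mul_nonneg hδ hsum)
  calc _ ≤ dirichletEnergy G v * (4 * M * ∑ x, ‖v x‖ ^ 2) := sq_sum_abs_norm_sq_sub_le hM v
    _ = 4 * M * dirichletEnergy G v * ∑ x, ‖v x‖ ^ 2 := by ring
    _ ≤ δ ^ 2 * (∑ x, ‖v x‖ ^ 2) * ∑ x, ‖v x‖ ^ 2 := mul_le_mul_of_nonneg_right hv hsum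
    _ = (δ * ∑ x, ‖v x‖ ^ 2) ^ 2 := by ring

end Energy

section LazyWalk

variable [DecidableEq V] {𝕜 : Type*} [RCLike 𝕜]

/-- The Laplacian of a graph as an operator on `ℓ²` of its vertices. -/
noncomputable def laplacian (𝕜 : Type*) [RCLike 𝕜] :
    EuclideanSpace 𝕜 V →L[𝕜] EuclideanSpace 𝕜 V :=
  Matrix.toEuclideanCLM (𝕜 := 𝕜) (G.lapMatrix 𝕜)

/-- The averaging operator `1 - (2M)⁻¹ L`, where `L` is the Laplacian. For an `M`-regular graph it
is the transition operator of the lazy random walk, which stays put with probability `1 / 2` and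
otherwise moves to a uniformly chosen neighbour. -/
noncomputable def lazyWalk (𝕜 : Type*) [RCLike 𝕜] (M : ℕ) :
    EuclideanSpace 𝕜 V →L[𝕜] EuclideanSpace 𝕜 V :=
  1 - (2 * M : 𝕜)⁻¹ • laplacian G 𝕜

theorem laplacian_apply (v : EuclideanSpace 𝕜 V) (x : V) :
    laplacian G 𝕜 v x = ∑ y ∈ G.neighborFinset x, (v x - v y) := by
  simp [laplacian, SimpleGraph.lapMatrix_mulVec_apply]

theorem lazyWalk_apply (M : ℕ) (v : EuclideanSpace 𝕜 V) :
    lazyWalk G 𝕜 M v = v - (2 * M : 𝕜)⁻¹ • laplacian G 𝕜 v := rfl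

theorem lazyWalk_one (M : ℕ) :
    lazyWalk G 𝕜 M (WithLp.toLp 2 1) = WithLp.toLp 2 1 := by
  ext x
  simp [lazyWalk_apply, laplacian_apply]

theorem one_le_norm_lazyWalk_pow [Nonempty V] (M n : ℕ) : 1 ≤ ‖lazyWalk G 𝕜 M ^ n‖ := by
  set one : EuclideanSpace 𝕜 V := WithLp.toLp 2 1 with hone
  have hfix : (lazyWalk G 𝕜 M ^ n) one = one := by
    rw [FunLike.coe_pow_eq_iterate]
    exact Function.iterate_fixed (lazyWalk_one G M) n
  have hne : one ≠ 0 := by simp [hone]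
  have hle := (lazyWalk G 𝕜 M ^ n).le_opNorm one
  rw [hfix] at hle
  exact (le_mul_iff_one_le_left (norm_pos_iff.mpr hne)).mp hle

theorem two_mul_re_inner_laplacian (v : EuclideanSpace 𝕜 V) :
    2 * RCLike.re (inner 𝕜 v (laplacian G 𝕜 v)) = dirichletEnergy G v := by
  have hpolar (a b : 𝕜) :
      2 * RCLike.re (inner 𝕜 a (a - b)) = ‖a - b‖ ^ 2 + (‖a‖ ^ 2 - ‖b‖ ^ 2) := by
    rw [norm_sub_sq (𝕜 := 𝕜), inner_sub_right, map_sub, inner_self_eq_norm_sq]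
    ring
  simp only [PiLp.inner_apply, laplacian_apply, inner_sum, map_sum, Finset.mul_sum, hpolar]
  simp only [Finset.sum_add_distrib, Finset.sum_sub_distrib]
  rw [sum_neighborFinset_swap G fun x _ => ‖v x‖ ^ 2, sub_self, add_zero, dirichletEnergy]

variable {G}

theorem norm_sq_laplacian_le {M : ℕ} (hM : ∀ x, G.degree x ≤ M) (v : EuclideanSpace 𝕜 V) :
    ‖laplacian G 𝕜 v‖ ^ 2 ≤ M * dirichletEnergy G v := by
  rw [EuclideanSpace.norm_sq_eq, dirichletEnergy, Finset.mul_sum]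
  refine Finset.sum_le_sum fun x _ => ?_
  calc ‖laplacian G 𝕜 v x‖ ^ 2
      ≤ (∑ y ∈ G.neighborFinset x, ‖v x - v y‖) ^ 2 := by
        rw [laplacian_apply]
        gcongr
        exact norm_sum_le _ _
    _ ≤ (G.neighborFinset x).card * ∑ y ∈ G.neighborFinset x, ‖v x - v y‖ ^ 2 :=
        sq_sum_le_card_mul_sum_sq
    _ ≤ M * ∑ y ∈ G.neighborFinset x, ‖v x - v y‖ ^ 2 := by
        gcongr
        exact hM x

theorem norm_sq_lazyWalk_le {M : ℕ} (hM : ∀ x, G.degree x ≤ M) (v : EuclideanSpace 𝕜 V) :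
    ‖lazyWalk G 𝕜 M v‖ ^ 2 ≤ ‖v‖ ^ 2 - dirichletEnergy G v / (4 * M) := by
  have hre : RCLike.re (inner 𝕜 v ((2 * M : 𝕜)⁻¹ • laplacian G 𝕜 v))
      = (2 * M : ℝ)⁻¹ * RCLike.re (inner 𝕜 v (laplacian G 𝕜 v)) := by
    rw [inner_smul_right, ← RCLike.re_ofReal_mul]
    push_cast
    rfl
  have hnorm : ‖(2 * M : 𝕜)⁻¹ • laplacian G 𝕜 v‖ ^ 2
      = (2 * M : ℝ)⁻¹ ^ 2 * ‖laplacian G 𝕜 v‖ ^ 2 := by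
    simp [norm_smul, mul_pow]
  calc ‖lazyWalk G 𝕜 M v‖ ^ 2
      = ‖v‖ ^ 2 - (2 * M : ℝ)⁻¹ * dirichletEnergy G v
          + (2 * M : ℝ)⁻¹ ^ 2 * ‖laplacian G 𝕜 v‖ ^ 2 := by
        rw [lazyWalk_apply, norm_sub_sq (𝕜 := 𝕜), hre, hnorm, ← two_mul_re_inner_laplacian]
        ring
    _ ≤ ‖v‖ ^ 2 - (2 * M : ℝ)⁻¹ * dirichletEnergy G v
          + (2 * M : ℝ)⁻¹ ^ 2 * (M * dirichletEnergy G v) := by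
        gcongr
        exact norm_sq_laplacian_le hM v
    _ = ‖v‖ ^ 2 - dirichletEnergy G v / (4 * M) := by
        rcases eq_or_ne (M : ℝ) 0 with h0 | h0
        · simp [h0]
        · field_simp
          ring

theorem exists_dirichletEnergy_pow_lazyWalk_le {M : ℕ} (hM0 : 0 < M) (hM : ∀ x, G.degree x ≤ M)
    {q c : ℝ} {n : ℕ} (hq : 0 ≤ q) (hc : 0 ≤ c) (hqc : q ^ n < c ^ 2)
    {v : EuclideanSpace 𝕜 V} (hv : v ≠ 0) (hcv : c * ‖v‖ ≤ ‖(lazyWalk G 𝕜 M ^ n) v‖) :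
    ∃ k < n, (lazyWalk G 𝕜 M ^ k) v ≠ 0 ∧ dirichletEnergy G ((lazyWalk G 𝕜 M ^ k) v)
      ≤ 4 * M * (1 - q) * ‖(lazyWalk G 𝕜 M ^ k) v‖ ^ 2 := by
  obtain ⟨k, hk, hlt⟩ : ∃ k < n, q * ‖(lazyWalk G 𝕜 M ^ k) v‖ ^ 2
      < ‖(lazyWalk G 𝕜 M ^ (k + 1)) v‖ ^ 2 := by
    by_contra! hdecay
    have hgeom : ‖(lazyWalk G 𝕜 M ^ n) v‖ ^ 2 ≤ q ^ n * ‖v‖ ^ 2 := by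
      simpa using le_geom (u := fun k => ‖(lazyWalk G 𝕜 M ^ k) v‖ ^ 2) hq n hdecay
    have hstrict : q ^ n * ‖v‖ ^ 2 < c ^ 2 * ‖v‖ ^ 2 := by gcongr
    have hsq : c ^ 2 * ‖v‖ ^ 2 ≤ ‖(lazyWalk G 𝕜 M ^ n) v‖ ^ 2 := by
      rw [← mul_pow]
      gcongr
    linarith
  set w := (lazyWalk G 𝕜 M ^ k) v with hw
  rw [pow_succ' (lazyWalk G 𝕜 M), mul_apply_eq_comp, ← hw] at hlt
  have hstep := norm_sq_lazyWalk_le hM w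
  refine ⟨k, hk, fun h0 => ?_, ?_⟩
  · rw [show w = 0 from h0, map_zero] at hlt
    simp at hlt
  · have hdiv : dirichletEnergy G w / (4 * M) ≤ (1 - q) * ‖w‖ ^ 2 := by linarith
    rw [div_le_iff₀ (by positivity)] at hdiv
    linarith

end LazyWalk

end Graph

section Propagation

variable {Y : Type*} [PseudoMetricSpace Y]

/-- The coordinate-free form of the propagation condition `T_{x,y} = 0` for `d(x, y) > R`, for
operators on `l²(Y, E)` with respect to the counting measure. -/
def PropagatesWithin {𝕜 E : Type*} [NormedField 𝕜] [SeminormedAddCommGroup E] [NormedSpace 𝕜 E]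
    (R : ℝ) (A : PiLp 2 (fun _ : Y => E) →L[𝕜] PiLp 2 (fun _ : Y => E)) : Prop :=
  ∀ v, Function.support (A v) ⊆ Metric.cthickening R (Function.support v)

namespace PropagatesWithin

variable {𝕜 E : Type*} [NormedField 𝕜] [SeminormedAddCommGroup E] [NormedSpace 𝕜 E]
  {R R' : ℝ} {A : PiLp 2 (fun _ : Y => E) →L[𝕜] PiLp 2 (fun _ : Y => E)}

theorem mono (hA : PropagatesWithin R A) (h : R ≤ R') : PropagatesWithin R' A := fun v =>
  (hA v).trans (Metric.cthickening_mono h _)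

theorem pow (hR : 0 ≤ R) (hA : PropagatesWithin R A) (n : ℕ) :
    PropagatesWithin (n * R) (A ^ n) := by
  intro v
  induction n with
  | zero =>
    rw [pow_zero, one_apply_eq_self]
    exact Metric.self_subset_cthickening _
  | succ n ih =>
    calc Function.support ((A ^ (n + 1)) v)
        ⊆ Metric.cthickening R (Function.support ((A ^ n) v)) := by
          rw [pow_succ', mul_apply_eq_comp]
          exact hA _
      _ ⊆ Metric.cthickening R (Metric.cthickening (n * R) (Function.support v)) :=
          Metric.cthickening_subset_of_subset _ ih
      _ ⊆ Metric.cthickening (R + n * R) (Function.support v) :=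
          Metric.cthickening_cthickening_subset hR (by positivity) _
      _ = Metric.cthickening ((n + 1 : ℕ) * R) (Function.support v) := by
          push_cast
          ring_nf

theorem ediam_support_le (hR : 0 ≤ R) (hA : PropagatesWithin R A) {S : ℝ} (hS : 0 ≤ S)
    {v : PiLp 2 fun _ : Y => E}
    (hv : Metric.ediam (Function.support v) ≤ ENNReal.ofReal S) :
    Metric.ediam (Function.support (A v)) ≤ ENNReal.ofReal (S + 2 * R) := by
  lift R to NNReal using hR
  calc Metric.ediam (Function.support (A v))
      ≤ Metric.ediam (Metric.cthickening R (Function.support v)) := Metric.ediam_mono (hA v)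
    _ ≤ Metric.ediam (Function.support v) + 2 * R := Metric.ediam_cthickening_le R
    _ ≤ ENNReal.ofReal S + 2 * R := by gcongr
    _ = ENNReal.ofReal (S + 2 * R) := by
        rw [ENNReal.ofReal_add hS (by positivity), ENNReal.ofReal_mul zero_le_two]
        simp

end PropagatesWithin

theorem propagatesWithin_lazyWalk {𝕜 : Type*} [RCLike 𝕜] [Fintype Y] [DecidableEq Y]
    (G : SimpleGraph Y) [DecidableRel G.Adj] {R : ℝ} (hG : ∀ x y, G.Adj x y → dist x y ≤ R)
    (M : ℕ) : PropagatesWithin R (lazyWalk G 𝕜 M) := by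
  intro v x hx
  contrapose! hx
  have hself : v x = 0 := by
    by_contra h
    exact hx (Metric.self_subset_cthickening _ h)
  have hnbr : ∀ y ∈ G.neighborFinset x, v x - v y = 0 := by
    intro y hy
    by_contra h
    refine hx (Metric.mem_cthickening_of_dist_le x y R _ ?_ (hG x y (by simpa using hy)))
    simpa [hself] using h
  have hlap : laplacian G 𝕜 v x = 0 := by rw [laplacian_apply, Finset.sum_eq_zero hnbr]
  simp [lazyWalk_apply, hself, hlap]

/-- The graph on `Y` joining distinct points at distance at most `R`: the `1`-skeleton of the
Vietoris–Rips complex. -/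
def ripsGraph (Y : Type*) [PseudoMetricSpace Y] (R : ℝ) : SimpleGraph Y where
  Adj x y := x ≠ y ∧ dist x y ≤ R
  symm := ⟨fun x y h => ⟨h.1.symm, dist_comm x y ▸ h.2⟩⟩
  loopless := ⟨fun _ h => h.1 rfl⟩

noncomputable instance (R : ℝ) : DecidableRel (ripsGraph Y R).Adj := Classical.decRel _

theorem sum_neighborFinset_ripsGraph [Fintype Y] {A : Type*} [AddCommMonoid A] (R : ℝ) (x : Y)
    {g : Y → A} (hg : g x = 0) :
    ∑ y ∈ (ripsGraph Y R).neighborFinset x, g y = ∑ y with dist x y ≤ R, g y := by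
  refine Finset.sum_subset (fun y hy => ?_) (fun y hy hxy => ?_)
  · simpa using ((SimpleGraph.mem_neighborFinset _ _ _).mp hy).2
  · obtain rfl : x = y := by
      by_contra hne
      exact hxy ((SimpleGraph.mem_neighborFinset _ _ _).mpr ⟨hne, by simpa using hy⟩)
    exact hg

theorem sum_sum_neighborFinset_ripsGraph {X : Type*} [PseudoMetricSpace X] {F : Finset X} (R : ℝ)
    {A : Type*} [AddCommMonoid A] {g : X → X → A} (hg : ∀ x, g x x = 0) :
    ∑ x : F, ∑ y ∈ (ripsGraph F R).neighborFinset x, g x y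
      = ∑ x ∈ F, ∑ y ∈ F with dist x y ≤ R, g x y := by
  rw [← Finset.sum_coe_sort F]
  refine Finset.sum_congr rfl fun x _ => ?_
  rw [sum_neighborFinset_ripsGraph R x (hg x), Finset.sum_filter, Finset.sum_filter,
    ← Finset.sum_coe_sort F]
  rfl

theorem BoundedGeometry.exists_degree_ripsGraph_le {X : Type*} [MetricSpace X]
    (hX : BoundedGeometry X) {R : ℝ} (hR : 0 < R) :
    ∃ M : ℕ, 0 < M ∧ ∀ (F : Finset X) (x : F), (ripsGraph F R).degree x ≤ M := by
  obtain ⟨N, hN⟩ := hX R hR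
  refine ⟨N + 1, N.succ_pos, fun F x => Nat.le_succ_of_le ?_⟩
  have hball : Subtype.val '' ((ripsGraph F R).neighborFinset x : Set F)
      ⊆ Metric.closedBall (x : X) R := by
    rintro _ ⟨y, hy, rfl⟩
    exact Metric.mem_closedBall'.mpr ((SimpleGraph.mem_neighborFinset _ _ _).mp hy).2
  have hcard := (Set.encard_le_encard hball).trans (hN x)
  rw [Subtype.val_injective.encard_image, Set.encard_coe_eq_coe_finsetCard] at hcard
  exact_mod_cast hcard

end Propagation

section UniformMeasure

open ProbabilityTheory

variable {X : Type*} [MeasurableSpace X] [DiscreteMeasurableSpace X] (F : Finset X)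

theorem lintegral_uniformOn (g : X → ℝ≥0∞) :
    ∫⁻ x, g x ∂uniformOn F = (F.card : ℝ≥0∞)⁻¹ * ∑ x ∈ F, g x := by
  simp [uniformOn, ProbabilityTheory.cond, lintegral_smul_measure, lintegral_finset]

theorem uniformOn_singleton_ne_zero_iff {x : X} : uniformOn (F : Set X) {x} ≠ 0 ↔ x ∈ F := by
  classical
  rw [← Finset.coe_singleton, uniformOn_apply_finset]
  simp [Finset.inter_singleton]

theorem ae_uniformOn_iff {p : X → Prop} :
    (∀ᵐ x ∂uniformOn (F : Set X), p x) ↔ ∀ x ∈ F, p x := by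
  refine ⟨fun h x hx => ?_, fun h => ae_cond_of_forall_mem F.measurableSet h⟩
  by_contra hp
  exact (uniformOn_singleton_ne_zero_iff F).mpr hx
    (measure_mono_null (Set.singleton_subset_iff.mpr hp) h)

section Lp

variable {H : Type*} [NormedAddCommGroup H]

theorem norm_sq_lp_uniformOn (φ : Lp H 2 (uniformOn (F : Set X))) :
    ‖φ‖ ^ 2 = (F.card : ℝ)⁻¹ * ∑ x ∈ F, ‖φ x‖ ^ 2 := by
  rw [Lp.norm_def, eLpNorm_eq_lintegral_rpow_enorm_toReal two_ne_zero ENNReal.ofNat_ne_top,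
    lintegral_uniformOn, ← ENNReal.toReal_rpow, ENNReal.toReal_ofNat, ← Real.sqrt_eq_rpow,
    Real.sq_sqrt ENNReal.toReal_nonneg, ENNReal.toReal_mul, ENNReal.toReal_sum (by simp)]
  simp

variable [NormedSpace ℂ H]

/-- The elements of `l²` of the uniform probability measure on `F` as functions on `F`. The factor
`|F|^(-1/2)` makes up for the difference between this measure and the counting measure. -/
noncomputable def lpUniformOnIsometry :
    Lp H 2 (uniformOn (F : Set X)) →ₗᵢ[ℂ] PiLp 2 fun _ : F => H where
  toFun φ := WithLp.toLp 2 fun x => (√F.card)⁻¹ • φ x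
  map_add' φ ψ := by
    ext x
    have hadd : (φ + ψ) x = φ x + ψ x := (ae_uniformOn_iff F).mp (Lp.coeFn_add φ ψ) x x.2
    exact (congrArg _ hadd).trans (smul_add _ _ _)
  map_smul' a φ := by
    ext x
    have hsmul : (a • φ) x = a • φ x := (ae_uniformOn_iff F).mp (Lp.coeFn_smul a φ) x x.2
    exact (congrArg _ hsmul).trans (smul_comm _ _ _)
  norm_map' φ := by
    rw [← sq_eq_sq₀ (norm_nonneg _) (norm_nonneg _), norm_sq_lp_uniformOn, PiLp.norm_sq_eq_of_L2,
      ← Finset.sum_coe_sort F, Finset.mul_sum]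
    simp [norm_smul, mul_pow]

theorem lpUniformOnIsometry_apply (φ : Lp H 2 (uniformOn (F : Set X))) (x : F) :
    lpUniformOnIsometry F φ x = (√F.card)⁻¹ • φ x := rfl

theorem lpUniformOnIsometry_indicatorConstLp [DecidableEq X] (x : F) (v : H) :
    lpUniformOnIsometry F (indicatorConstLp 2 (measurableSet_singleton (x : X))
      (measure_ne_top _ _) v) = PiLp.single 2 x ((√F.card)⁻¹ • v) := by
  ext z
  rw [lpUniformOnIsometry_apply, (ae_uniformOn_iff F).mp indicatorConstLp_coeFn z z.2]
  rcases eq_or_ne z x with rfl | hzx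
  · simp
  · simp [hzx]

theorem surjective_lpUniformOnIsometry :
    Function.Surjective (lpUniformOnIsometry (H := H) F) := by
  classical
  intro v
  refine ⟨∑ x : F, indicatorConstLp 2 (measurableSet_singleton (x : X)) (measure_ne_top _ _)
    (√F.card • v x), ?_⟩
  ext z
  have hcard : √(F.card : ℝ) ≠ 0 := by
    have := Finset.card_ne_zero_of_mem z.2
    positivity
  simp only [map_sum, lpUniformOnIsometry_indicatorConstLp, inv_smul_smul₀ hcard]
  simp

/-- `l²` of the uniform probability measure on `F` is isometric to `l²(F)`. -/
noncomputable def lpUniformOnEquiv :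
    Lp H 2 (uniformOn (F : Set X)) ≃ₗᵢ[ℂ] PiLp 2 fun _ : F => H :=
  .ofSurjective (lpUniformOnIsometry F) (surjective_lpUniformOnIsometry F)

theorem lpUniformOnEquiv_apply_ne_zero_iff (φ : Lp H 2 (uniformOn (F : Set X))) (x : F) :
    lpUniformOnEquiv F φ x ≠ 0 ↔ φ x ≠ 0 := by
  have := Finset.card_ne_zero_of_mem x.2
  simp [lpUniformOnEquiv, lpUniformOnIsometry_apply, this]

end Lp

variable {H : Type*} [NormedAddCommGroup H] [InnerProductSpace ℂ H]

theorem l2Support_eq_image_support (φ : Lp H 2 (uniformOn (F : Set X))) :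
    l2Support φ = Subtype.val '' Function.support (lpUniformOnEquiv F φ) := by
  ext x
  simp [l2Support, uniformOn_singleton_ne_zero_iff, lpUniformOnEquiv_apply_ne_zero_iff, and_comm]

theorem support_lpUniformOnEquiv_single_subset (x : F) (v : H) :
    Function.support (lpUniformOnEquiv F (single (uniformOn (F : Set X)) x v)) ⊆ {x} := by
  classical
  change Function.support (lpUniformOnIsometry F (indicatorConstLp 2 _ _ v)) ⊆ {x}
  rw [lpUniformOnIsometry_indicatorConstLp]
  exact Pi.support_single_subset

end UniformMeasure

section Localization

open ProbabilityTheory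

variable {X : Type*} [MetricSpace X]

theorem PropagatesWithin.hasPropagation_conj [MeasurableSpace X] [DiscreteMeasurableSpace X]
    {H : Type*} [NormedAddCommGroup H] [InnerProductSpace ℂ H] (F : Finset X)
    {R : ℝ} (hR : 0 ≤ R) {A : PiLp 2 (fun _ : F => H) →L[ℂ] PiLp 2 (fun _ : F => H)}
    (hA : PropagatesWithin R A) :
    HasPropagation R ((lpUniformOnEquiv F).symm.toContinuousLinearEquiv.toContinuousLinearMap ∘L
      A ∘L (lpUniformOnEquiv F).toContinuousLinearEquiv.toContinuousLinearMap) := by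
  intro x y hx hy hxy v
  rw [uniformOn_singleton_ne_zero_iff] at hx hy
  by_contra hne
  have hmem : (⟨x, hx⟩ : F) ∈
      Function.support (A (lpUniformOnEquiv F (single (uniformOn (F : Set X)) y v))) := by
    rw [Function.mem_support, ← (lpUniformOnEquiv F).apply_symm_apply (A _),
      lpUniformOnEquiv_apply_ne_zero_iff]
    exact hne
  have hdist := Metric.cthickening_subset_of_subset R
    (support_lpUniformOnEquiv_single_subset F ⟨y, hy⟩ v) (hA _ hmem)
  rw [Metric.cthickening_singleton _ hR, Metric.mem_closedBall] at hdist
  exact hxy.not_ge hdist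

theorem ONL.exists_localized (hX : ONL X) :
    ∃ c : ℝ, 0 < c ∧ ∀ R : ℝ, 0 < R → ∃ S : ℝ, 0 < S ∧ ∀ F : Finset X, F.Nonempty →
      ∀ (H : Type) [NormedAddCommGroup H] [InnerProductSpace ℂ H] [CompleteSpace H]
        [TopologicalSpace.SeparableSpace H] [Nontrivial H]
        (A : PiLp 2 (fun _ : F => H) →L[ℂ] PiLp 2 (fun _ : F => H)), PropagatesWithin R A →
        ∃ v : PiLp 2 (fun _ : F => H), ‖v‖ = 1 ∧
          Metric.ediam (Function.support v) ≤ ENNReal.ofReal S ∧ c * ‖A‖ ≤ ‖A v‖ := by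
  obtain ⟨c, hc, hloc⟩ := hX
  refine ⟨c, hc, fun R hR => ?_⟩
  obtain ⟨S, hS, hloc⟩ := hloc R hR
  refine ⟨S, hS, fun F hF H _ _ _ _ _ A hA => ?_⟩
  let _ : MeasurableSpace X := ⊤
  have : IsProbabilityMeasure (uniformOn (F : Set X)) :=
    isProbabilityMeasure_uniformOn F.finite_toSet hF
  let e : Lp H 2 (uniformOn (F : Set X)) ≃ₗᵢ[ℂ] PiLp 2 fun _ : F => H := lpUniformOnEquiv F
  obtain ⟨φ, hφ, hdiam, hT⟩ := hloc (uniformOn (F : Set X)) H _ (hA.hasPropagation_conj F hR.le)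
  have hnorm : ‖e.symm.toContinuousLinearEquiv.toContinuousLinearMap ∘L
      A ∘L e.toContinuousLinearEquiv.toContinuousLinearMap‖ = ‖A‖ := by
    have hleft := LinearIsometry.norm_toContinuousLinearMap_comp e.symm.toLinearIsometry
      (g := A ∘L e.toContinuousLinearEquiv.toContinuousLinearMap)
    exact hleft.trans (A.opNorm_comp_linearIsometryEquiv e)
  refine ⟨e φ, (e.norm_map φ).trans hφ, ?_, ?_⟩
  · rwa [l2Support_eq_image_support, isometry_subtype_coe.ediam_image] at hdiam
  · rw [hnorm] at hT
    exact hT.trans_eq (e.symm.norm_map _)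

theorem ONL.exists_dirichletEnergy_le (hONL : ONL X) (hX : BoundedGeometry X) {R η : ℝ} (hR : 0 < R)
    (hη : 0 < η) : ∃ S : ℝ, 0 < S ∧ ∀ F : Finset X, F.Nonempty →
      ∃ v : EuclideanSpace ℂ F, v ≠ 0 ∧
        Metric.ediam (Function.support v) ≤ ENNReal.ofReal S ∧
        dirichletEnergy (ripsGraph F R) v ≤ η * ‖v‖ ^ 2 := by
  classical
  obtain ⟨M, hM0, hM⟩ := hX.exists_degree_ripsGraph_le hR
  obtain ⟨c, hc, hloc⟩ := hONL.exists_localized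
  set q : ℝ := 1 - min 1 (η / (4 * M)) with hq
  have hq0 : 0 ≤ q := sub_nonneg.mpr (min_le_left _ _)
  have hq1 : q < 1 := sub_lt_self _ (by positivity)
  have hqη : 4 * M * (1 - q) ≤ η := by
    rw [hq, sub_sub_cancel, ← le_div_iff₀' (by positivity)]
    exact min_le_right _ _
  obtain ⟨n, hn⟩ := exists_pow_lt_of_lt_one (sq_pos_of_pos hc) hq1
  obtain ⟨S, hS, hloc⟩ := hloc ((n + 1) * R) (by positivity)
  refine ⟨S + 2 * (n * R), by positivity, fun F hF => ?_⟩
  have : Nonempty F := hF.to_subtype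
  set W := lazyWalk (ripsGraph F R) ℂ M
  have hW : PropagatesWithin R W := propagatesWithin_lazyWalk _ (fun _ _ => And.right) M
  obtain ⟨v, hv, hdiam, hcv⟩ := hloc F hF ℂ (W ^ n)
    ((hW.pow hR.le n).mono (by gcongr; linarith))
  have hcW : c * ‖v‖ ≤ ‖(W ^ n) v‖ := by
    rw [hv]
    exact (mul_le_mul_of_nonneg_left (one_le_norm_lazyWalk_pow _ M n) hc.le).trans hcv
  obtain ⟨k, hk, hne, henergy⟩ := exists_dirichletEnergy_pow_lazyWalk_le hM0 (hM F) hq0 hc.le hn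
    (norm_ne_zero_iff.mp (hv ▸ one_ne_zero)) hcW
  refine ⟨(W ^ k) v, hne, ?_, henergy.trans (by gcongr)⟩
  exact ((hW.pow hR.le k).mono (by gcongr)).ediam_support_le (by positivity) hS.le hdiam

theorem ONL.ulaFunction (hONL : ONL X) (hX : BoundedGeometry X) : ULAFunction X := by
  intro R ε hR hε
  obtain ⟨M, hM0, hM⟩ := hX.exists_degree_ripsGraph_le hR
  obtain ⟨S, hS, hloc⟩ :=
    hONL.exists_dirichletEnergy_le hX hR (η := (ε / 2) ^ 2 / (4 * M)) (by positivity)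
  refine ⟨S, hS, fun F hF => ?_⟩
  obtain ⟨v, hv, hdiam, henergy⟩ := hloc F hF
  let f : X → ℝ := Function.extend Subtype.val (fun x : F => ‖v x‖ ^ 2) 0
  have hf (x : F) : f x = ‖v x‖ ^ 2 := Subtype.val_injective.extend_apply _ _ x
  have hsupport : Function.support f = Subtype.val '' Function.support v := by
    rw [Function.support_extend_zero Subtype.val_injective, Function.support_pow _ two_ne_zero]
    simp [Function.support]
  have hfinite : (Function.support f).Finite := hsupport ▸ Set.toFinite _
  have hf1 : Memℓp f 1 := (memℓp_zero hfinite).of_exponent_ge zero_le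
  refine ⟨⟨f, hf1⟩, ?_, ?_⟩
  · exact (hsupport ▸ isometry_subtype_coe.ediam_image _).trans_le hdiam
  have hvariation : ∑ x, ∑ y ∈ (ripsGraph F R).neighborFinset x, |‖v x‖ ^ 2 - ‖v y‖ ^ 2|
      ≤ ε / 2 * ∑ x, ‖v x‖ ^ 2 := by
    refine sum_abs_norm_sq_sub_le (hM F) (half_pos hε).le ?_
    rwa [← EuclideanSpace.norm_sq_eq, ← le_div_iff₀' (by positivity), ← div_mul_eq_mul_div]
  have hpos : 0 < ∑ x, ‖v x‖ ^ 2 := by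
    rw [← EuclideanSpace.norm_sq_eq]
    positivity
  calc ∑ x ∈ F, ∑ y ∈ F with dist x y ≤ R, |f x - f y|
      = ∑ x, ∑ y ∈ (ripsGraph F R).neighborFinset x, |‖v x‖ ^ 2 - ‖v y‖ ^ 2| := by
        rw [← sum_sum_neighborFinset_ripsGraph R (by simp)]
        simp only [hf]
    _ < ε * ∑ x, ‖v x‖ ^ 2 := hvariation.trans_lt (by gcongr; exact half_lt_self hε)
    _ = ε * ∑ x ∈ F, |f x| := by
        rw [← Finset.sum_coe_sort F]
        simp only [hf, abs_sq]

end Localization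

end CoarseGeometry

theorem mainTheorem4 {X : Type*} [MetricSpace X] (hX : CoarseGeometry.BoundedGeometry X)
    (hONL : CoarseGeometry.ONL X) : CoarseGeometry.ULA X := by
  have hfun : CoarseGeometry.ULAFunction X := hONL.ulaFunction hX
  exact ⟨hfun, hfun.ulaSet⟩
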